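/- Throughout, a context-free grammar $G=(N,\Sigma,P,S)$ has finitely many rules, and its dependency digraph $D(G)$ has vertex set $N$ and an edge from $A$ to $B$ whenever $P$ contains a rule $A\to\alpha B\beta$ with $\alpha,\beta\in(N\cup\Sigma)^*$. For a language $L$ let $\mathrm{Var}(L)$ be the smallest number $|N|$ of nonterminals of a context-free grammar generating $L$, and let $\mathrm{Var}_{\mathrm{ac}}(L)$ be the smallest $|N|$ among those context-free grammars generating $L$ whose start symbol $S$ lies on no cycle (loops included) of $D(G)$. A nonempty word is primitive if it is not a power $v^m$ of a word $v$ with $m\neq 1$; every nonempty word $u$ is a power of a unique primitive word $\widehat u$. For nonempty words write $x\sim y$ if $\widehat x=zv$ and $\widehat y=vz$ for some words $z,v$; this is an equivalence relation. **Theorem.** Let $w_1,\dots,w_n$ be pairwise distinct nonempty words over an arbitrary alphabet, let $L=w_1^*+\dots+w_n^*$ (the union of the languages $w_i^*$), and let $k>1$ be an integer. 1. $\mathrm{Var}_{\mathrm{ac}}(L)=k$ if and only if the set $\{w_1,\dots,w_n\}$ is divided into exactly $k-1$ equivalence classes by $\sim$. 2. If the words $w_1,\dots,w_n$ do not all commute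 pairwise (that is, $w_iw_j\ne w_jw_i$ for some $i,j$), then $\mathrm{Var}(L)=k$ if and only if the set $\{w_1,\dots,w_n\}$ is divided into exactly $k-1$ equivalence classes by $\sim$. -/

import Mathlib

open scoped Computability

/-- The power `v ^ m` of a word `v`, that is, `v` written `m` times. -/
def wordPow {T : Type*} (v : List T) (m : ℕ) : List T := (List.replicate m v).flatten

/-- A nonempty word is primitive if it is not a power of a word with an exponent other than `1`. -/
def IsPrimitiveWord {T : Type*} (p : List T) : Prop :=
  p ≠ [] ∧ ∀ (v : List T) (m : ℕ), p = wordPow v m → m = 1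

theorem wordPow_add {T : Type*} (v : List T) (a b : ℕ) :
    wordPow v (a + b) = wordPow v a ++ wordPow v b := by
  unfold wordPow
  rw [List.replicate_add, List.flatten_append]

theorem wordPow_zero {T : Type*} (v : List T) : wordPow v 0 = [] := rfl

theorem wordPow_one {T : Type*} (v : List T) : wordPow v 1 = v := by simp [wordPow]

theorem wordPow_mul {T : Type*} (v : List T) (a b : ℕ) :
    wordPow v (a * b) = wordPow (wordPow v a) b := by
  induction b with
  | zero => rfl
  | succ b ih => rw [Nat.mul_succ, wordPow_add, wordPow_add, ih, wordPow_one]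

theorem length_wordPow {T : Type*} (v : List T) (m : ℕ) :
    (wordPow v m).length = m * v.length := by
  simp [wordPow]

theorem exists_wordPow_of_commute {T : Type*} (N : ℕ) :
    ∀ x y : List T, x.length + y.length ≤ N → x ++ y = y ++ x →
      ∃ (z : List T) (a b : ℕ), x = wordPow z a ∧ y = wordPow z b := by
  induction N with
  | zero =>
    intro x y h _
    have hx : x = [] := List.length_eq_zero_iff.1 (by omega)
    have hy : y = [] := List.length_eq_zero_iff.1 (by omega)
    exact ⟨[], 0, 0, hx, hy⟩
  | succ N ih =>
    have key : ∀ x y : List T, x.length ≤ y.length → x.length + y.length ≤ N + 1 →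
        x ++ y = y ++ x → ∃ (z : List T) (a b : ℕ), x = wordPow z a ∧ y = wordPow z b := by
      intro x y hle hN hc
      by_cases hx : x = []
      · exact ⟨y, 0, 1, hx, (wordPow_one y).symm⟩
      · have hpos : 0 < x.length := List.length_pos_iff.2 hx
        have hpre : x <+: y :=
          List.prefix_of_prefix_length_le ⟨y, hc⟩ ⟨x, rfl⟩ hle
        obtain ⟨t, rfl⟩ := hpre
        have hlen : x.length + t.length ≤ N := by
          simp only [List.length_append] at hN
          omega
        have hc' : x ++ t = t ++ x := by
          rw [List.append_assoc] at hc
          exact List.append_cancel_left hc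
        obtain ⟨z, a, b, h1, h2⟩ := ih x t hlen hc'
        exact ⟨z, a, a + b, h1, by rw [wordPow_add, ← h1, ← h2]⟩
    intro x y hN hc
    rcases le_total x.length y.length with h | h
    · exact key x y h hN hc
    · obtain ⟨z, a, b, h1, h2⟩ := key y x h (by omega) hc.symm
      exact ⟨z, b, a, h2, h1⟩

/-- Every nonempty word is a power of exactly one primitive word. -/
theorem existsUnique_primitiveRoot {T : Type*} (u : List T) (hu : u ≠ []) :
    ∃! p : List T, IsPrimitiveWord p ∧ ∃ m : ℕ, u = wordPow p m := by
  have hex : ∀ (N : ℕ) (u : List T), u.length ≤ N → u ≠ [] →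
      ∃ p : List T, IsPrimitiveWord p ∧ ∃ m : ℕ, u = wordPow p m := by
    intro N
    induction N with
    | zero =>
      intro u h hu
      exact absurd (List.length_eq_zero_iff.1 (by omega)) hu
    | succ N ih =>
      intro u h hu
      by_cases hp : IsPrimitiveWord u
      · exact ⟨u, hp, 1, (wordPow_one u).symm⟩
      · simp only [IsPrimitiveWord, not_and, not_forall] at hp
        obtain ⟨v, m, hv, hm⟩ := hp hu
        have hl : u.length = m * v.length := by rw [hv, length_wordPow]
        have hupos : 0 < u.length := List.length_pos_iff.2 hu
        have hm0 : m ≠ 0 := by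
          intro h0
          rw [h0, Nat.zero_mul] at hl
          omega
        have hvpos : 0 < v.length := by
          rcases Nat.eq_zero_or_pos v.length with h0 | h0
          · rw [h0, Nat.mul_zero] at hl
            omega
          · exact h0
        have hvN : v.length ≤ N := by
          have h2m : 2 * v.length ≤ m * v.length := Nat.mul_le_mul_right _ (by omega)
          omega
        obtain ⟨p, hpp, j, hj⟩ := ih v hvN (List.length_pos_iff.1 hvpos)
        exact ⟨p, hpp, j * m, by rw [wordPow_mul, ← hj, hv]⟩
  obtain ⟨p, hp, m, hm⟩ := hex _ u le_rfl hu
  refine ⟨p, ⟨hp, m, hm⟩, ?_⟩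
  rintro q ⟨hq, j, hj⟩
  -- both roots are prefixes of `u`, and `p ++ q` and `q ++ p` are prefixes of `u ++ u`
  have hcons : ∀ (v : List T) (i : ℕ), u = wordPow v i → v ++ u = u ++ v ∧ v <+: u := by
    intro v i hi
    have h1 : v ++ u = u ++ v := by
      rw [hi]
      have := wordPow_add v 1 i
      rw [Nat.add_comm, wordPow_add, wordPow_one] at this
      exact this.symm
    refine ⟨h1, ?_⟩
    cases i with
    | zero => exact absurd hi hu
    | succ i =>
      refine ⟨wordPow v i, ?_⟩
      rw [hi, Nat.add_comm, wordPow_add, wordPow_one]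
  obtain ⟨hpc, hpp⟩ := hcons p m hm
  obtain ⟨hqc, hqp⟩ := hcons q j hj
  have h1 : p ++ q <+: u ++ u := by
    refine ((List.prefix_append_right_inj p).2 hqp).trans ?_
    rw [hpc]
    exact (List.prefix_append_right_inj u).2 hpp
  have h2 : q ++ p <+: u ++ u := by
    refine ((List.prefix_append_right_inj q).2 hpp).trans ?_
    rw [hqc]
    exact (List.prefix_append_right_inj u).2 hqp
  have hcomm : q ++ p = p ++ q :=
    (List.prefix_of_prefix_length_le h2 h1 (by simp [Nat.add_comm])).eq_of_length
      (by simp [Nat.add_comm])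
  obtain ⟨z, a, b, ha, hb⟩ := exists_wordPow_of_commute _ q p le_rfl hcomm
  have ha1 := hq.2 z a ha
  have hb1 := hp.2 z b hb
  rw [ha, hb, ha1, hb1]

open Classical in
/-- The primitive root of a word: the unique primitive word of which the nonempty word `u` is a
power. (The value at the empty word is irrelevant and is set to be empty.) -/
noncomputable def primitiveRoot {T : Type*} (u : List T) : List T :=
  if hu : u ≠ [] then (existsUnique_primitiveRoot u hu).choose else []

theorem primitiveRoot_spec {T : Type*} (u : List T) (hu : u ≠ []) :
    IsPrimitiveWord (primitiveRoot u) ∧ ∃ m : ℕ, u = wordPow (primitiveRoot u) m := by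
  rw [primitiveRoot, dif_pos hu]
  exact (existsUnique_primitiveRoot u hu).choose_spec.1

/-- Two words are related if their primitive roots are conjugate, that is, of the form
`z ++ v` and `v ++ z`, which is to say cyclic shifts of each other. -/
noncomputable def rootConj (T : Type*) : Setoid (List T) :=
  (List.IsRotated.setoid T).comap primitiveRoot

/-- The relation `rootConj` unfolded. -/
theorem rootConj_iff {T : Type*} (x y : List T) :
    rootConj T x y ↔
      ∃ z v : List T, primitiveRoot x = z ++ v ∧ primitiveRoot y = v ++ z := by
  change (primitiveRoot x) ~r (primitiveRoot y) ↔ _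
  constructor
  · intro h
    obtain ⟨i, hi, h⟩ := List.isRotated_iff_mod.1 h
    refine ⟨(primitiveRoot x).take i, (primitiveRoot x).drop i, by simp, ?_⟩
    rw [← h, List.rotate_eq_drop_append_take hi]
  · rintro ⟨z, v, h1, h2⟩
    rw [h1, h2]
    exact List.isRotated_append

/-- The set of equivalence classes into which a set `A` of words is divided by the relation
"the primitive roots are conjugate". -/
def rootConjClasses {T : Type*} (A : Set (List T)) : Set (Set A) :=
  ((rootConj T).comap (Subtype.val : A → List T)).classes

/-- The language `w₁* + … + wₙ*`. -/
noncomputable def starSum {T : Type*} {n : ℕ} (w : Fin n → List T) : Language T :=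
  ∑ i, ({w i} : Language T)∗

/-- The nonterminal complexity `Var L`: the smallest number of nonterminals of a context-free
grammar that generates `L` (and `⊤` if there is no such grammar with finitely many
nonterminals). -/
noncomputable def nonterminalComplexity {T : Type*} (L : Language T) : ℕ∞ :=
  ⨅ (G : ContextFreeGrammar T) (_ : G.language = L), ENat.card G.NT

/-- The edges of the dependency digraph of `G`: there is an edge from `A` to `B` if `G` has a rule
`A → α B β`. -/
def DependencyEdge {T : Type*} (G : ContextFreeGrammar T) (A B : G.NT) : Prop :=
  ∃ r ∈ G.rules, r.input = A ∧
    ∃ α β : List (Symbol T G.NT), r.output = α ++ [Symbol.nonterminal B] ++ β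

/-- The initial nonterminal of `G` lies on no cycle (loops included) of the dependency digraph. -/
def InitialAcyclic {T : Type*} (G : ContextFreeGrammar T) : Prop :=
  ¬ Relation.TransGen (DependencyEdge G) G.initial G.initial

/-- The smallest number of nonterminals of a context-free grammar that generates `L` and whose
initial nonterminal lies on no cycle of the dependency digraph (and `⊤` if there is no such
grammar with finitely many nonterminals). -/
noncomputable def acyclicNonterminalComplexity {T : Type*} (L : Language T) : ℕ∞ :=
  ⨅ (G : ContextFreeGrammar T) (_ : G.language = L) (_ : InitialAcyclic G), ENat.card G.NT

/-! Both complexities equal the number of classes plus one: each class needs its own pumping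
nonterminal, and the start symbol is an extra one.

Lower bound. In a long power of `w i`, pump at a nonterminal `A` of the derivation tree. The pumped
window is short, so a long factor of the power survives outside it. Iterating the pump stays in the
language, hence gives a power of some `w s`. Words whose powers share a long factor have conjugate
roots (`rootConj_of_common_infix`, a weak Fine–Wilf theorem), so `w s` and the pumped words all lie
in the class of `w i` (`exists_pumpsClass`). Nesting two pumps of one nonterminal inside a single
word shows that it serves only one class (`PumpsClass.rootConj_of_pumpsClass`). The start symbol
serves none: in the acyclic case because `A` lies on a cycle, in the other case because a pumpable
start symbol makes all `w i` commute (`commute_of_initial_pump`).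

Upper bound. Conjugate roots let one nonterminal, generating the powers of a single word `P`, serve
its whole class: a suitable power of `w i` factors as `v z` with `z v = P`, so that `(v z)^(t+1) = v
P^t z` (`language_starSumGrammar`). The start symbol of this grammar occurs in no right-hand side.
-/

/-! ### Combinatorics on words: powers, rotations, primitive roots. -/

theorem wordPow_succ {T : Type*} (v : List T) (m : ℕ) :
    wordPow v (m + 1) = v ++ wordPow v m := by
  rw [Nat.add_comm, wordPow_add, wordPow_one]

theorem wordPow_nil {T : Type*} (m : ℕ) : wordPow ([] : List T) m = [] :=
  List.length_eq_zero_iff.1 (by simp [length_wordPow])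

theorem reverse_wordPow {T : Type*} (v : List T) (m : ℕ) :
    (wordPow v m).reverse = wordPow v.reverse m := by
  simp [wordPow, List.reverse_flatten]

theorem wordPow_append_swap {T : Type*} (x y : List T) (m : ℕ) :
    wordPow (x ++ y) m ++ x = x ++ wordPow (y ++ x) m := by
  induction m with
  | zero => simp [wordPow_zero]
  | succ m ih => rw [wordPow_succ, wordPow_succ, List.append_assoc, ih]; simp

theorem rotate_wordPow {T : Type*} (v : List T) (m k : ℕ) :
    (wordPow v m).rotate k = wordPow (v.rotate k) m := by
  induction k with
  | zero => simp
  | succ k ih =>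
    rw [← List.rotate_rotate, ih, ← List.rotate_rotate]
    -- Only rotation by a single letter remains, which is `wordPow_append_swap` with a one-letter
    -- first factor.
    generalize v.rotate k = u
    cases u with
    | nil => simp [wordPow_nil]
    | cons a u =>
      cases m with
      | zero => simp [wordPow_zero]
      | succ m =>
        have h := wordPow_append_swap [a] u (m + 1)
        rw [wordPow_succ] at h ⊢
        simp only [List.cons_append, List.cons.injEq, true_and] at h
        simpa using h

/-- A factor of a power of `w` is a prefix of a power of a conjugate of `w`. -/
theorem exists_isRotated_of_infix {T : Type*} {f w : List T} {a : ℕ}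
    (h : f <:+: wordPow w a) : ∃ w', w' ~r w ∧ f <+: wordPow w' a := by
  obtain ⟨α, β, h⟩ := h
  -- Rotating the whole power by the length of what precedes `f` brings `f` to the front.
  refine ⟨w.rotate α.length, (List.IsRotated.forall _ _), β ++ α, ?_⟩
  rw [← rotate_wordPow, ← h, List.append_assoc, List.rotate_append_length_eq, List.append_assoc]

/-- Period `x` moves the prefix `y` of `f` to position `|x|`, so `x ++ y` is a prefix of `f`; by
symmetry so is `y ++ x`, and the two have equal length. The bound `|x| + |y|` is weaker than that of
Fine and Wilf but suffices. -/
theorem commute_of_common_prefix {T : Type*} {f x y : List T} {a b : ℕ}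
    (hx : f <+: wordPow x a) (hy : f <+: wordPow y b) (hf : x.length + y.length ≤ f.length) :
    x ++ y = y ++ x := by
  have key : ∀ {x y : List T} {a b : ℕ}, f <+: wordPow x a → f <+: wordPow y b →
      x.length + y.length ≤ f.length → x ++ y <+: f := by
    intro x y a b hx hy hf
    have hpre : ∀ {z : List T} {c : ℕ}, f <+: wordPow z c → z.length ≤ f.length → z <+: f := by
      intro z c hz hl
      cases c with
      | zero =>
        have : f = [] := by simpa [wordPow_zero] using hz
        subst this
        have : z = [] := List.length_eq_zero_iff.1 (by simpa using hl)
        simp [this]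
      | succ c =>
        exact List.prefix_of_prefix_length_le ⟨_, (wordPow_succ z c).symm⟩ hz hl
    obtain ⟨t, ht⟩ := hpre hx (by omega)
    have hyf := hpre hy (by omega)
    have htf : t <+: f := by
      refine List.prefix_of_prefix_length_le (l₃ := wordPow x a) ?_ hx ?_
      · cases a with
        | zero =>
          have h0 : f = [] := by simpa [wordPow_zero] using hx
          rw [h0] at ht
          simp [(List.append_eq_nil_iff.1 ht).2]
        | succ a =>
          have h1 : t <+: wordPow x a := by
            rw [← ht, wordPow_succ, List.prefix_append_right_inj] at hx
            exact hx
          exact h1.trans ⟨x, by rw [wordPow_add, wordPow_one]⟩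
      · rw [← ht]; simp
    have hyt : y <+: t := by
      refine List.prefix_of_prefix_length_le hyf htf ?_
      have := congrArg List.length ht
      simp only [List.length_append] at this
      omega
    rw [← ht]
    exact (List.prefix_append_right_inj x).2 hyt
  exact (List.prefix_of_prefix_length_le (key hx hy hf) (key hy hx (by omega))
    (by simp [Nat.add_comm])).eq_of_length (by simp [Nat.add_comm])

theorem primitiveRoot_eq_of_commute {T : Type*} {x y : List T} (hx : x ≠ []) (hy : y ≠ [])
    (h : x ++ y = y ++ x) : primitiveRoot x = primitiveRoot y := by
  obtain ⟨z, a, b, ha, hb⟩ := exists_wordPow_of_commute _ x y le_rfl h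
  have hz : z ≠ [] := by
    rintro rfl
    exact hx (by rw [ha, wordPow_nil])
  obtain ⟨hp, m, hm⟩ := primitiveRoot_spec z hz
  have key : ∀ (u : List T) (c : ℕ), u ≠ [] → u = wordPow z c →
      primitiveRoot u = primitiveRoot z := by
    intro u c hu huc
    refine (existsUnique_primitiveRoot u hu).unique (primitiveRoot_spec u hu) ⟨hp, m * c, ?_⟩
    rw [wordPow_mul, ← hm, huc]
  rw [key x a hx ha, key y b hy hb]

theorem isPrimitiveWord_rotate {T : Type*} {p : List T} (hp : IsPrimitiveWord p) (k : ℕ) :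
    IsPrimitiveWord (p.rotate k) := by
  refine ⟨fun h => hp.1 (List.rotate_eq_nil_iff.1 h), fun v m h => ?_⟩
  obtain ⟨j, hj⟩ : p.rotate k ~r p := List.IsRotated.forall _ _
  refine hp.2 (v.rotate j) m ?_
  rw [← rotate_wordPow, ← h, hj]

theorem primitiveRoot_rotate {T : Type*} {x : List T} (hx : x ≠ []) (k : ℕ) :
    primitiveRoot (x.rotate k) = (primitiveRoot x).rotate k := by
  have hx' : x.rotate k ≠ [] := fun h => hx (List.rotate_eq_nil_iff.1 h)
  obtain ⟨hp, m, hm⟩ := primitiveRoot_spec x hx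
  refine (existsUnique_primitiveRoot _ hx').unique (primitiveRoot_spec _ hx')
    ⟨isPrimitiveWord_rotate hp k, m, ?_⟩
  rw [← rotate_wordPow, ← hm]

/-- Two nonempty words whose powers share a sufficiently long factor have conjugate roots. -/
theorem rootConj_of_common_infix {T : Type*} {f x y : List T} {a b : ℕ} (hx : x ≠ [])
    (hy : y ≠ []) (hfx : f <:+: wordPow x a) (hfy : f <:+: wordPow y b)
    (hf : x.length + y.length ≤ f.length) : rootConj T x y := by
  obtain ⟨x', hxr, hx'⟩ := exists_isRotated_of_infix hfx
  obtain ⟨y', hyr, hy'⟩ := exists_isRotated_of_infix hfy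
  obtain ⟨i, rfl⟩ := hxr.symm
  obtain ⟨j, rfl⟩ := hyr.symm
  have h := primitiveRoot_eq_of_commute (by simpa using hx) (by simpa using hy)
    (commute_of_common_prefix hx' hy' (by simpa using hf))
  rw [primitiveRoot_rotate hx, primitiveRoot_rotate hy] at h
  have h1 : primitiveRoot x ~r (primitiveRoot x).rotate i := ⟨i, rfl⟩
  rw [h] at h1
  exact h1.trans (List.IsRotated.forall _ _)

theorem eq_wordPow_of_append_left {T : Type*} {p t : List T} {a b : ℕ} (hp : p ≠ [])
    (h : wordPow p b ++ t = wordPow p a) : ∃ c, t = wordPow p c := by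
  have hl := congrArg List.length h
  have hpos : 0 < p.length := List.length_pos_iff.2 hp
  simp only [List.length_append, length_wordPow] at hl
  have hba : b ≤ a := Nat.le_of_mul_le_mul_right (show b * p.length ≤ a * p.length by omega) hpos
  obtain ⟨c, rfl⟩ := Nat.exists_eq_add_of_le hba
  rw [wordPow_add] at h
  exact ⟨c, List.append_cancel_left h⟩

theorem eq_wordPow_of_append_right {T : Type*} {p t : List T} {a b : ℕ} (hp : p ≠ [])
    (h : t ++ wordPow p b = wordPow p a) : ∃ c, t = wordPow p c := by
  have h' := congrArg List.reverse h
  rw [List.reverse_append, reverse_wordPow, reverse_wordPow] at h'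
  obtain ⟨c, hc⟩ := eq_wordPow_of_append_left (by simpa using hp) h'
  exact ⟨c, by rw [← List.reverse_reverse t, hc, reverse_wordPow, List.reverse_reverse]⟩

/-- Used with `x` and `y` the two sides of a pump of the start symbol, to recover the inserted word
`t`. -/
theorem eq_wordPow_of_middle {T : Type*} {p x y t : List T} {a b : ℕ} (hp : p ≠ [])
    (h1 : x ++ t ++ y = wordPow p a) (h0 : x ++ y = wordPow p b)
    (h : (∃ c, x = wordPow p c) ∨ ∃ c, y = wordPow p c) : ∃ c, t = wordPow p c := by
  rcases h with ⟨c, rfl⟩ | ⟨c, rfl⟩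
  · obtain ⟨d, rfl⟩ := eq_wordPow_of_append_left hp h0
    rw [List.append_assoc] at h1
    obtain ⟨e, he⟩ := eq_wordPow_of_append_left hp h1
    exact eq_wordPow_of_append_right hp he
  · obtain ⟨d, rfl⟩ := eq_wordPow_of_append_right hp h0
    obtain ⟨e, he⟩ := eq_wordPow_of_append_right hp h1
    exact eq_wordPow_of_append_left hp he

theorem commute_of_wordPow {T : Type*} (p : List T) (a b : ℕ) :
    wordPow p a ++ wordPow p b = wordPow p b ++ wordPow p a := by
  rw [← wordPow_add, ← wordPow_add, Nat.add_comm]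

theorem mem_starSum {T : Type*} {n : ℕ} (w : Fin n → List T) (x : List T) :
    x ∈ starSum w ↔ ∃ i m, x = wordPow (w i) m := by
  have hs : ∀ v : List T, x ∈ ({v} : Language T)∗ ↔ ∃ m, x = wordPow v m := by
    intro v
    rw [Language.mem_kstar]
    constructor
    · rintro ⟨L, rfl, hL⟩
      exact ⟨L.length, by rw [wordPow, ← List.eq_replicate_of_mem (fun y hy => hL y hy)]⟩
    · rintro ⟨m, rfl⟩
      exact ⟨_, rfl, fun y hy => List.eq_of_mem_replicate hy⟩
  have hsum : ∀ s : Finset (Fin n),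
      x ∈ ∑ i ∈ s, ({w i} : Language T)∗ ↔ ∃ i ∈ s, ∃ m, x = wordPow (w i) m := by
    intro s
    induction s using Finset.induction_on with
    | empty => simp [Language.notMem_zero]
    | insert a s ha ih => rw [Finset.sum_insert ha, Language.mem_add, ih, hs]; simp
  rw [starSum, hsum]
  simp

/-! ### Derivation forests and forests with a hole. -/

/-- `Yields G n s w`: the sentential form `s` derives the terminal word `w` by a derivation
forest with `n` inner nodes. -/
inductive Yields {T : Type*} (G : ContextFreeGrammar T) :
    ℕ → List (Symbol T G.NT) → List T → Prop
  | nil : Yields G 0 [] []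
  | terminal (a : T) {n : ℕ} {s : List (Symbol T G.NT)} {w : List T} :
      Yields G n s w → Yields G n (Symbol.terminal a :: s) (a :: w)
  | nonterminal (r : ContextFreeRule T G.NT) (hr : r ∈ G.rules) {n m : ℕ}
      {s : List (Symbol T G.NT)} {v w : List T} :
      Yields G n r.output v → Yields G m s w →
      Yields G (n + m + 1) (Symbol.nonterminal r.input :: s) (v ++ w)

namespace Yields

variable {T : Type*} {G : ContextFreeGrammar T}

theorem append {n m : ℕ} {s t : List (Symbol T G.NT)} {v w : List T}
    (h : Yields G n s v) (h' : Yields G m t w) : Yields G (n + m) (s ++ t) (v ++ w) := by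
  induction h with
  | nil => simpa using h'
  | terminal a _ ih => exact ih.terminal a
  | @nonterminal r hr n₁ n₂ _ _ _ h₁ _ _ ih₂ =>
    have := Yields.nonterminal r hr h₁ ih₂
    rw [← List.append_assoc] at this
    convert this using 1
    · omega
    · simp

theorem exists_of_append {t : List (Symbol T G.NT)} : ∀ {s : List (Symbol T G.NT)} {n : ℕ}
    {w : List T}, Yields G n (s ++ t) w → ∃ n₁ n₂ w₁ w₂, n = n₁ + n₂ ∧ w = w₁ ++ w₂ ∧
      Yields G n₁ s w₁ ∧ Yields G n₂ t w₂ := by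
  intro s
  induction s with
  | nil => intro n w h; exact ⟨0, n, [], w, by simp, rfl, .nil, h⟩
  | cons a s ih =>
    intro n w h
    rw [List.cons_append] at h
    cases h with
    | terminal b h =>
      obtain ⟨n₁, n₂, w₁, w₂, rfl, rfl, h₁, h₂⟩ := ih h
      exact ⟨n₁, n₂, b :: w₁, w₂, rfl, rfl, h₁.terminal b, h₂⟩
    | nonterminal r hr h' h =>
      obtain ⟨n₁, n₂, w₁, w₂, rfl, rfl, h₁, h₂⟩ := ih h
      exact ⟨_, n₂, _, w₂, by omega, by simp, .nonterminal r hr h' h₁, h₂⟩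

theorem terminals (w : List T) : Yields G 0 (w.map Symbol.terminal) w := by
  induction w with
  | nil => exact .nil
  | cons a w ih => exact ih.terminal a

theorem rule {r : ContextFreeRule T G.NT} (hr : r ∈ G.rules) {n : ℕ} {w : List T}
    (h : Yields G n r.output w) : Yields G (n + 1) [Symbol.nonterminal r.input] w := by
  simpa using Yields.nonterminal r hr h .nil

theorem derives {n : ℕ} {s : List (Symbol T G.NT)} {w : List T} (h : Yields G n s w) :
    G.Derives s (w.map Symbol.terminal) := by
  induction h with
  | nil => exact Relation.ReflTransGen.refl
  | terminal a _ ih => simpa using ih.append_left [Symbol.terminal a]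
  | nonterminal r hr _ _ ih₁ ih₂ =>
    refine ContextFreeGrammar.Produces.trans_derives ⟨r, hr, .head _⟩ ?_
    rw [List.map_append]
    exact (ih₁.append_right _).trans (ih₂.append_left _)

theorem of_derives {s : List (Symbol T G.NT)} {w : List T}
    (h : G.Derives s (w.map Symbol.terminal)) : ∃ n, Yields G n s w := by
  induction h using Relation.ReflTransGen.head_induction_on with
  | refl => exact ⟨0, terminals w⟩
  | head h _ ih =>
    obtain ⟨r, hr, hrw⟩ := h
    obtain ⟨p, q, rfl, rfl⟩ := hrw.exists_parts
    obtain ⟨n, ih⟩ := ih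
    obtain ⟨n₁, n₂, w₁, w₂, rfl, rfl, h₁, h₂⟩ := exists_of_append ih
    obtain ⟨n₃, n₄, w₃, w₄, rfl, rfl, h₃, h₄⟩ := exists_of_append h₁
    exact ⟨_, (h₃.append (rule hr h₄)).append h₂⟩

theorem mem_language {w : List T} :
    w ∈ G.language ↔ ∃ n, Yields G n [Symbol.nonterminal G.initial] w := by
  rw [ContextFreeGrammar.mem_language_iff]
  exact ⟨of_derives, fun ⟨_, h⟩ => h.derives⟩

end Yields

/-- `Hole G n s B u z`: from `s` one reaches `u B z` with `n` inner nodes. It is stated by the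
effect on derivation forests, together with a path to `B` in the dependency digraph. -/
structure Hole {T : Type*} (G : ContextFreeGrammar T) (n : ℕ) (s : List (Symbol T G.NT))
    (B : G.NT) (u z : List T) : Prop where
  path : ∃ C, Symbol.nonterminal C ∈ s ∧ Relation.ReflTransGen (DependencyEdge G) C B
  fill : ∀ {m : ℕ} {v : List T}, Yields G m [Symbol.nonterminal B] v →
    Yields G (n + m) s (u ++ v ++ z)

namespace Hole

variable {T : Type*} {G : ContextFreeGrammar T}

theorem terminal {n : ℕ} {s : List (Symbol T G.NT)} {B : G.NT} {u z : List T}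
    (h : Hole G n s B u z) (a : T) : Hole G n (Symbol.terminal a :: s) B (a :: u) z where
  path := by
    obtain ⟨C, hC, hp⟩ := h.path
    exact ⟨C, List.mem_cons_of_mem _ hC, hp⟩
  fill hv := (h.fill hv).terminal a

theorem cons {n m : ℕ} {s : List (Symbol T G.NT)} {B : G.NT} {u z w : List T}
    {a : Symbol T G.NT} (h' : Yields G n [a] w) (h : Hole G m s B u z) :
    Hole G (n + m) (a :: s) B (w ++ u) z where
  path := by
    obtain ⟨C, hC, hp⟩ := h.path
    exact ⟨C, List.mem_cons_of_mem _ hC, hp⟩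
  fill hv := by
    have := h'.append (h.fill hv)
    simpa [Nat.add_assoc] using this

theorem rule {r : ContextFreeRule T G.NT} (hr : r ∈ G.rules) {n : ℕ} {B : G.NT} {u z : List T}
    (h : Hole G n r.output B u z) : Hole G (n + 1) [Symbol.nonterminal r.input] B u z where
  path := by
    obtain ⟨C, hC, hp⟩ := h.path
    obtain ⟨α, β, hαβ⟩ := List.append_of_mem hC
    exact ⟨r.input, by simp, hp.head ⟨r, hr, rfl, α, β, by simpa using hαβ⟩⟩
  fill hv := by
    have := (h.fill hv).rule hr
    convert this using 1
    omega

theorem append_right {n m : ℕ} {s t : List (Symbol T G.NT)} {B : G.NT} {u z w : List T}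
    (h : Hole G n s B u z) (h' : Yields G m t w) : Hole G (n + m) (s ++ t) B u (z ++ w) where
  path := by
    obtain ⟨C, hC, hp⟩ := h.path
    exact ⟨C, List.mem_append_left _ hC, hp⟩
  fill hv := by
    have := (h.fill hv).append h'
    rw [List.append_assoc] at this ⊢
    convert this using 1
    · omega
    · simp

theorem self {n : ℕ} {s : List (Symbol T G.NT)} {w : List T} {A : G.NT} (h : Yields G n s w) :
    Hole G n (Symbol.nonterminal A :: s) A [] w where
  path := ⟨A, by simp, .refl⟩
  fill hv := by
    have := hv.append h
    rw [Nat.add_comm]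
    simpa using this

theorem fill_pow {n : ℕ} {B : G.NT} {x y : List T}
    (h : Hole G n [Symbol.nonterminal B] B x y) {m : ℕ} {v : List T}
    (hv : Yields G m [Symbol.nonterminal B] v) (i : ℕ) :
    ∃ k, Yields G k [Symbol.nonterminal B] (wordPow x i ++ v ++ wordPow y i) := by
  induction i with
  | zero => exact ⟨m, by simpa [wordPow_zero] using hv⟩
  | succ i ih =>
    obtain ⟨k, hk⟩ := ih
    refine ⟨n + k, ?_⟩
    have := h.fill hk
    have hx : wordPow x (i + 1) = x ++ wordPow x i := by
      rw [Nat.add_comm, wordPow_add, wordPow_one]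
    rw [hx, wordPow_add, wordPow_one]
    simpa using this

end Hole

/-! ### The pumping lemma. -/

/-- A derivation from `s` of `w` with `n` inner nodes in which a nonterminal `B` is repeated on
a path, where the subtree at the upper occurrence of `B` yields a word of length at most `K`. -/
def HasPump {T : Type*} (G : ContextFreeGrammar T) (K n : ℕ) (s : List (Symbol T G.NT))
    (w : List T) : Prop :=
  ∃ (B : G.NT) (u x v y z : List T) (n₁ n₂ n₃ : ℕ), w = u ++ (x ++ v ++ y) ++ z ∧
    n = n₁ + (n₂ + 1 + n₃) ∧ (x ++ v ++ y).length ≤ K ∧ Hole G n₁ s B u z ∧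
    Hole G (n₂ + 1) [Symbol.nonterminal B] B x y ∧ Yields G n₃ [Symbol.nonterminal B] v ∧
    Relation.TransGen (DependencyEdge G) B B

theorem HasPump.of_hole {T : Type*} {G : ContextFreeGrammar T} {K n m : ℕ}
    {s t : List (Symbol T G.NT)} {w p q : List T} (h : HasPump G K n s w)
    (hole : ∀ {k : ℕ} {B : G.NT} {u z : List T}, Hole G k s B u z →
      Hole G (k + m) t B (p ++ u) (z ++ q)) :
    HasPump G K (n + m) t (p ++ w ++ q) := by
  obtain ⟨B, u, x, v, y, z, n₁, n₂, n₃, rfl, rfl, hK, h₁, h₂, h₃, hB⟩ := h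
  exact ⟨B, p ++ u, x, v, y, z ++ q, n₁ + m, n₂, n₃, by simp, by omega, hK, hole h₁, h₂, h₃, hB⟩

/-- A derivation yields a short word, or reaches a nonterminal in `R`, or contains a pump. -/
theorem Yields.short_or_reaches_or_hasPump {T : Type*} {G : ContextFreeGrammar T}
    [Fintype G.NT] {b : ℕ} (hb : 1 ≤ b) (hrules : ∀ r ∈ G.rules, r.output.length ≤ b)
    {n : ℕ} {s : List (Symbol T G.NT)} {w : List T} (h : Yields G n s w) :
    ∀ R : Finset G.NT, w.length ≤ s.length * b ^ (Fintype.card G.NT - R.card) ∨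
      (∃ B ∈ R, ∃ (u v z : List T) (n₁ n₂ : ℕ), w = u ++ v ++ z ∧ n = n₁ + n₂ ∧
        Hole G n₁ s B u z ∧ Yields G n₂ [Symbol.nonterminal B] v) ∨
      HasPump G (b ^ (Fintype.card G.NT + 1)) n s w := by
  classical
  induction h with
  | nil => intro R; left; simp
  | @terminal a n s w h ih =>
    intro R
    rcases ih R with h1 | ⟨B, hB, u, v, z, n₁, n₂, rfl, rfl, h1, h2⟩ | h1
    · left
      have : 1 ≤ b ^ (Fintype.card G.NT - R.card) := Nat.one_le_pow _ _ hb
      simp only [List.length_cons, Nat.add_mul]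
      omega
    · right; left
      exact ⟨B, hB, a :: u, v, z, n₁, n₂, rfl, rfl, h1.terminal a, h2⟩
    · right; right
      have := h1.of_hole (m := 0) (p := [a]) (q := []) (t := Symbol.terminal a :: s)
        (fun h => by simpa using h.terminal a)
      simpa using this
  | @nonterminal r hr n m s v w h h' ih ih' =>
    intro R
    have hA := h.rule hr
    by_cases hR : r.input ∈ R
    · right; left
      exact ⟨r.input, hR, [], v, w, m, n + 1, by simp, by omega, Hole.self h', hA⟩
    have inner : ∀ {k : ℕ} {B : G.NT} {u z : List T}, Hole G k r.output B u z →
        Hole G (k + (m + 1)) (Symbol.nonterminal r.input :: s) B ([] ++ u) (z ++ w) := by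
      intro k B u z hh
      have := (hh.rule hr).append_right h'
      rw [show k + (m + 1) = k + 1 + m by omega]
      simpa using this
    have pump : HasPump G (b ^ (Fintype.card G.NT + 1)) n r.output v →
        HasPump G (b ^ (Fintype.card G.NT + 1)) (n + m + 1)
          (Symbol.nonterminal r.input :: s) (v ++ w) := by
      intro hp
      have := hp.of_hole inner
      simpa [Nat.add_assoc] using this
    -- With `R = ∅` the second alternative is impossible, so the subtree is short unless it already
    -- contains a pump. This bounds the window of any pump whose upper node is the present one.
    have hvlen : v.length ≤ b ^ (Fintype.card G.NT + 1) ∨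
        HasPump G (b ^ (Fintype.card G.NT + 1)) n r.output v := by
      rcases ih ∅ with h1 | ⟨B, hB, _⟩ | h1
      · left
        refine h1.trans ?_
        rw [Finset.card_empty, Nat.sub_zero, Nat.pow_succ, Nat.mul_comm]
        exact Nat.mul_le_mul_left _ (hrules r hr)
      · simp at hB
      · exact Or.inr h1
    rcases hvlen with hvlen | hp
    swap
    · exact Or.inr (Or.inr (pump hp))
    -- `R` plays the role of the nonterminals already met on the path. Adding `r.input` lowers the
    -- exponent by one, which pays for the factor `b` lost in expanding the rule.
    rcases ih (insert r.input R) with h1 | ⟨B, hB, u, x, z, n₁, n₂, rfl, rfl, h1, h2⟩ | h1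
    · rcases ih' R with h2 | ⟨B, hB, u, x, z, n₁, n₂, rfl, rfl, h2, h3⟩ | h2
      · left
        have hcard : R.card + 1 ≤ Fintype.card G.NT := by
          rw [← Finset.card_insert_of_notMem hR]
          exact Finset.card_le_univ _
        rw [Finset.card_insert_of_notMem hR] at h1
        have h3 : v.length ≤ b ^ (Fintype.card G.NT - R.card) := by
          refine h1.trans ((Nat.mul_le_mul_right _ (hrules r hr)).trans ?_)
          rw [← Nat.pow_succ', show (Fintype.card G.NT - (R.card + 1)).succ =
            Fintype.card G.NT - R.card by omega]
        simp only [List.length_append, List.length_cons, Nat.add_mul]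
        omega
      · right; left
        exact ⟨B, hB, v ++ u, x, z, n + 1 + n₁, n₂, by simp, by omega, Hole.cons hA h2, h3⟩
      · right; right
        have := h2.of_hole (m := n + 1) (p := v) (q := [])
          (t := Symbol.nonterminal r.input :: s)
          (fun {k} _ _ _ hh => by
            rw [Nat.add_comm k]
            simpa using Hole.cons hA hh)
        rw [List.append_nil] at this
        convert this using 1
        omega
    · rw [Finset.mem_insert] at hB
      rcases hB with rfl | hB
      -- The subtree reaches its own root label `r.input` again: this is the repetition.
      · right; right
        refine ⟨r.input, [], u, x, z, w, m, n₁, n₂, by simp, by omega, hvlen, Hole.self h',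
          h1.rule hr, h2, ?_⟩
        obtain ⟨C, hC, hp⟩ := h1.path
        obtain ⟨α, β, hαβ⟩ := List.append_of_mem hC
        exact Relation.TransGen.head' ⟨r, hr, rfl, α, β, by simpa using hαβ⟩ hp
      · right; left
        have := inner h1
        exact ⟨B, hB, u, x, z ++ w, n₁ + (m + 1), n₂, by simp, by omega, by simpa using this, h2⟩
    · exact Or.inr (Or.inr (pump h1))

/-- The pumping lemma for context-free grammars. -/
theorem exists_pumping_bound {T : Type*} (G : ContextFreeGrammar T) [Finite G.NT] :
    ∃ K : ℕ, ∀ w ∈ G.language, K < w.length →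
      ∃ (B : G.NT) (u x v y z : List T) (n₁ n₂ n₃ : ℕ), w = u ++ (x ++ v ++ y) ++ z ∧
        x ++ y ≠ [] ∧ (x ++ v ++ y).length ≤ K ∧
        Hole G n₁ [Symbol.nonterminal G.initial] B u z ∧
        Hole G n₂ [Symbol.nonterminal B] B x y ∧ Yields G n₃ [Symbol.nonterminal B] v ∧
        Relation.TransGen (DependencyEdge G) B B := by
  classical
  have := Fintype.ofFinite G.NT
  set b := G.rules.sup (fun r => r.output.length) + 1 with hb
  refine ⟨b ^ (Fintype.card G.NT + 1), fun w hw hlen => ?_⟩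
  have hex := Yields.mem_language.1 hw
  -- A derivation with the fewest inner nodes: an empty pump could be cut out of it, giving a
  -- smaller one.
  have hmin := Nat.find_spec hex
  have hrules : ∀ r ∈ G.rules, r.output.length ≤ b := fun r hr =>
    (Finset.le_sup (f := fun r => r.output.length) hr).trans (Nat.le_succ _)
  rcases hmin.short_or_reaches_or_hasPump (by omega) hrules ∅ with h | ⟨B, hB, _⟩ | h
  · have h1 : b ^ Fintype.card G.NT ≤ b ^ (Fintype.card G.NT + 1) :=
      Nat.pow_le_pow_right (by omega) (by omega)
    simp only [Finset.card_empty, Nat.sub_zero, List.length_singleton, Nat.one_mul] at h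
    omega
  · simp at hB
  · obtain ⟨B, u, x, v, y, z, n₁, n₂, n₃, hw', hn, hK, h₁, h₂, h₃, hB⟩ := h
    refine ⟨B, u, x, v, y, z, n₁, n₂ + 1, n₃, hw', ?_, hK, h₁, h₂, h₃, hB⟩
    intro hxy
    obtain ⟨rfl, rfl⟩ := List.append_eq_nil_iff.1 hxy
    refine Nat.find_min hex (m := n₁ + n₃) (by omega) ?_
    have := h₁.fill h₃
    rw [hw']
    simpa using this

/-! ### Lower bound: one nonterminal per class, none of them initial. -/

/-- For `I > |c|` and nonempty `x` one has `I * |x| ≥ |x| + |c|`; the threshold on `I` does not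
depend on `x`. -/
theorem rootConj_of_wordPow_infix {T : Type*} {x c α β : List T} {I m : ℕ} (hx : x ≠ [])
    (hc : c ≠ []) (h : α ++ wordPow x I ++ β = wordPow c m) (hI : c.length < I) :
    rootConj T x c := by
  refine rootConj_of_common_infix hx hc (f := wordPow x I) (a := I) (b := m)
    (List.infix_refl _) ⟨α, β, h⟩ ?_
  have hpos : 0 < x.length := List.length_pos_iff.2 hx
  rw [length_wordPow]
  obtain ⟨J, rfl⟩ := Nat.exists_eq_add_of_lt hI
  nlinarith

/-- The nonterminal `A` is accessible and productive, and it is pumped by words whose roots are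
conjugate to the root of `c`. -/
def PumpsClass {T : Type*} (G : ContextFreeGrammar T) (A : G.NT) (c : List T) : Prop :=
  ∃ (u x v y z : List T) (n₁ n₂ n₃ : ℕ), x ++ y ≠ [] ∧
    Hole G n₁ [Symbol.nonterminal G.initial] A u z ∧ Hole G n₂ [Symbol.nonterminal A] A x y ∧
    Yields G n₃ [Symbol.nonterminal A] v ∧
    (x ≠ [] → rootConj T x c) ∧ (y ≠ [] → rootConj T y c)

theorem length_le_sum {T : Type*} {n : ℕ} (w : Fin n → List T) (i : Fin n) :
    (w i).length ≤ ∑ j, (w j).length :=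
  Finset.single_le_sum (f := fun j => (w j).length) (fun _ _ => Nat.zero_le _)
    (Finset.mem_univ i)

section LowerBound

variable {T : Type*} {n : ℕ} {w : Fin n → List T} {G : ContextFreeGrammar T}

/-- Nesting the second pump inside the first puts high powers of pumped words of both classes into
one word of the language, a power of a single `w s`. -/
theorem PumpsClass.rootConj_of_pumpsClass (hne : ∀ i, w i ≠ []) (hG : G.language = starSum w) {A : G.NT}
    {c c' : List T} (h : PumpsClass G A c) (h' : PumpsClass G A c') : rootConj T c c' := by
  obtain ⟨u, x, v, y, z, n₁, n₂, n₃, hxy, h₁, h₂, h₃, hx, hy⟩ := h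
  obtain ⟨_, x', _, y', _, _, m₂, _, hxy', _, h₂', _, hx', hy'⟩ := h'
  -- `I` must exceed every `|w s|`, since `s` is known only after pumping `I` times.
  set I := ∑ j, (w j).length + 1 with hI
  obtain ⟨k₁, hk₁⟩ := h₂'.fill_pow h₃ I
  obtain ⟨k₂, hk₂⟩ := h₂.fill_pow hk₁ I
  have hL := Yields.mem_language.2 ⟨_, h₁.fill hk₂⟩
  rw [hG, mem_starSum] at hL
  obtain ⟨s, m, hs⟩ := hL
  have hIs : (w s).length < I := Nat.lt_succ_of_le (length_le_sum w s)
  have key : ∀ t : List T, t ≠ [] → wordPow t I <:+: wordPow (w s) m → rootConj T t (w s) := by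
    rintro t ht ⟨α, β, h⟩
    exact rootConj_of_wordPow_infix ht (hne s) h hIs
  rw [← hs] at key
  have hc : rootConj T c (w s) := by
    by_cases hx0 : x = []
    · have hy0 : y ≠ [] := by simpa [hx0] using hxy
      refine (rootConj T).trans' ((rootConj T).symm' (hy hy0)) (key y hy0 ?_)
      exact ⟨u ++ wordPow x I ++ (wordPow x' I ++ v ++ wordPow y' I), z, by simp⟩
    · refine (rootConj T).trans' ((rootConj T).symm' (hx hx0)) (key x hx0 ?_)
      exact ⟨u, (wordPow x' I ++ v ++ wordPow y' I) ++ wordPow y I ++ z, by simp⟩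
  have hc' : rootConj T c' (w s) := by
    by_cases hx0 : x' = []
    · have hy0 : y' ≠ [] := by simpa [hx0] using hxy'
      refine (rootConj T).trans' ((rootConj T).symm' (hy' hy0)) (key y' hy0 ?_)
      exact ⟨u ++ wordPow x I ++ (wordPow x' I ++ v), wordPow y I ++ z, by simp⟩
    · refine (rootConj T).trans' ((rootConj T).symm' (hx' hx0)) (key x' hx0 ?_)
      exact ⟨u ++ wordPow x I, v ++ wordPow y' I ++ wordPow y I ++ z, by simp⟩
  exact (rootConj T).trans' hc ((rootConj T).symm' hc')

theorem exists_pumpsClass [Finite G.NT] (hne : ∀ i, w i ≠ []) (hG : G.language = starSum w)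
    (i : Fin n) : ∃ A : G.NT, Relation.TransGen (DependencyEdge G) A A ∧
      PumpsClass G A (w i) := by
  obtain ⟨K, hK⟩ := exists_pumping_bound G
  set M := ∑ j, (w j).length with hM
  -- The window takes at most `K` letters, so `u` or `z` keeps at least `2 * M ≥ |w s| + |w i|` of
  -- them.
  have hlen : K + 4 * M + 1 ≤ (wordPow (w i) (K + 4 * M + 1)).length := by
    rw [length_wordPow]
    exact Nat.le_mul_of_pos_right _ (List.length_pos_iff.2 (hne i))
  obtain ⟨A, u, x, v, y, z, n₁, n₂, n₃, hw, hxy, hxvy, h₁, h₂, h₃, hA⟩ :=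
    hK (wordPow (w i) (K + 4 * M + 1))
      (by rw [hG, mem_starSum]; exact ⟨i, _, rfl⟩) (by omega)
  refine ⟨A, hA, u, x, v, y, z, n₁, n₂, n₃, hxy, h₁, h₂, h₃, ?_⟩
  obtain ⟨k, hk⟩ := h₂.fill_pow h₃ (M + 1)
  have hL := Yields.mem_language.2 ⟨_, h₁.fill hk⟩
  rw [hG, mem_starSum] at hL
  obtain ⟨s, m, hs⟩ := hL
  have his := length_le_sum w i
  have hss := length_le_sum w s
  have hsi : rootConj T (w s) (w i) := by
    have hl := congrArg List.length hw
    rw [List.length_append, List.length_append] at hl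
    rcases Nat.lt_or_ge u.length (2 * M) with hu | hu
    · refine rootConj_of_common_infix (hne s) (hne i) (f := z) (a := m) (b := K + 4 * M + 1) ?_ ?_ (by omega)
      · rw [← hs]; exact (List.suffix_append _ _).isInfix
      · rw [hw]; exact (List.suffix_append _ _).isInfix
    · refine rootConj_of_common_infix (hne s) (hne i) (f := u) (a := m) (b := K + 4 * M + 1) ?_ ?_ (by omega)
      · rw [← hs, List.append_assoc]; exact (List.prefix_append _ _).isInfix
      · rw [hw, List.append_assoc]; exact (List.prefix_append _ _).isInfix
  constructor
  · intro hx
    refine (rootConj T).trans' (rootConj_of_wordPow_infix hx (hne s) (α := u)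
      (β := v ++ wordPow y (M + 1) ++ z) (I := M + 1) (m := m) ?_ (by omega)) hsi
    rw [← hs]; simp
  · intro hy
    refine (rootConj T).trans' (rootConj_of_wordPow_infix hy (hne s)
      (α := u ++ wordPow x (M + 1) ++ v) (β := z) (I := M + 1) (m := m) ?_ (by omega)) hsi
    rw [← hs]; simp

/-- If the initial nonterminal can be pumped, then all the words commute. -/
theorem commute_of_initial_pump (hne : ∀ i, w i ≠ []) (hG : G.language = starSum w)
    {k : ℕ} {x y : List T} (hxy : x ++ y ≠ [])
    (h : Hole G k [Symbol.nonterminal G.initial] G.initial x y) (i j : Fin n) :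
    w i ++ w j = w j ++ w i := by
  set I := ∑ j, (w j).length + 1 with hI
  have hmem : ∀ t ∈ starSum w, ∃ s m, wordPow x I ++ t ++ wordPow y I = wordPow (w s) m := by
    intro t ht
    rw [← hG, Yields.mem_language] at ht
    obtain ⟨m, ht⟩ := ht
    obtain ⟨k, hk⟩ := h.fill_pow ht I
    have hL := Yields.mem_language.2 ⟨_, hk⟩
    rwa [hG, mem_starSum] at hL
  have hlong : ∀ (t : List T) s, t ≠ [] → t.length + (w s).length ≤ (wordPow t I).length := by
    intro t s ht
    have hpos : 0 < t.length := List.length_pos_iff.2 ht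
    have hs := length_le_sum w s
    rw [length_wordPow, hI]
    nlinarith
  -- `p` is the root of `x`, or of `y` if `x` is empty. It does not depend on `t`, although `s`
  -- does: the outer power forces `w s` to have root `p`.
  obtain ⟨p, hp, hpI, hpw⟩ : ∃ p : List T, p ≠ [] ∧
      ((∃ c, wordPow x I = wordPow p c) ∨ ∃ c, wordPow y I = wordPow p c) ∧
      ∀ t ∈ starSum w, ∃ c, wordPow x I ++ t ++ wordPow y I = wordPow p c := by
    by_cases hx : x = []
    · have hy : y ≠ [] := by simpa [hx] using hxy
      obtain ⟨hp, e, he⟩ := primitiveRoot_spec y hy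
      refine ⟨primitiveRoot y, hp.1, Or.inr ⟨e * I, by rw [wordPow_mul, ← he]⟩, ?_⟩
      intro t ht
      obtain ⟨s, m, hs⟩ := hmem t ht
      -- A common suffix is treated as a common prefix of the reversed words.
      have hc : y.reverse ++ (w s).reverse = (w s).reverse ++ y.reverse := by
        refine commute_of_common_prefix (f := (wordPow y I).reverse) (a := I) (b := m) ?_ ?_ ?_
        · rw [reverse_wordPow]
        · rw [← reverse_wordPow, ← hs]
          exact ⟨(wordPow x I ++ t).reverse, by simp⟩
        · simpa using hlong y s hy
      have hc' : y ++ w s = w s ++ y := by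
        have := congrArg List.reverse hc
        simpa using this.symm
      rw [primitiveRoot_eq_of_commute hy (hne s) hc']
      obtain ⟨e, he⟩ := (primitiveRoot_spec (w s) (hne s)).2
      exact ⟨e * m, by rw [hs, wordPow_mul, ← he]⟩
    · obtain ⟨hp, e, he⟩ := primitiveRoot_spec x hx
      refine ⟨primitiveRoot x, hp.1, Or.inl ⟨e * I, by rw [wordPow_mul, ← he]⟩, ?_⟩
      intro t ht
      obtain ⟨s, m, hs⟩ := hmem t ht
      have hc : x ++ w s = w s ++ x := by
        refine commute_of_common_prefix (f := wordPow x I) (a := I) (b := m)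
          (List.prefix_refl _) ?_ (hlong x s hx)
        rw [← hs, List.append_assoc]
        exact List.prefix_append _ _
      rw [primitiveRoot_eq_of_commute hx (hne s) hc]
      obtain ⟨e, he⟩ := (primitiveRoot_spec (w s) (hne s)).2
      exact ⟨e * m, by rw [hs, wordPow_mul, ← he]⟩
  have hpow : ∀ i, ∃ c, w i = wordPow p c := by
    intro i
    -- Comparing the pumped words around `w i` and around the empty word isolates `w i`.
    obtain ⟨a, ha⟩ := hpw (w i) ((mem_starSum w _).2 ⟨i, 1, (wordPow_one _).symm⟩)
    obtain ⟨b, hb⟩ := hpw [] ((mem_starSum w _).2 ⟨i, 0, rfl⟩)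
    exact eq_wordPow_of_middle hp ha (by simpa using hb) hpI
  obtain ⟨a, ha⟩ := hpow i
  obtain ⟨b, hb⟩ := hpow j
  rw [ha, hb, commute_of_wordPow]

/-- `hS` serves both cases: acyclicity gives its conclusion outright, noncommutativity refutes its
premise. Either way the classes inject into the noninitial nonterminals. -/
theorem ncard_rootConjClasses_add_one_le (hne : ∀ i, w i ≠ []) (hG : G.language = starSum w)
    (hS : ∀ (k : ℕ) (x y : List T), x ++ y ≠ [] →
      Hole G k [Symbol.nonterminal G.initial] G.initial x y →
      ¬ Relation.TransGen (DependencyEdge G) G.initial G.initial) :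
    (((rootConjClasses (Set.range w)).ncard + 1 : ℕ) : ℕ∞) ≤ ENat.card G.NT := by
  rcases finite_or_infinite G.NT with hfin | hinf
  swap
  · rw [ENat.card_eq_top_of_infinite]; exact le_top
  have hex : ∀ c : rootConjClasses (Set.range w), ∃ A : {A : G.NT // A ≠ G.initial},
      ∃ i, c.1 = {a : Set.range w | rootConj T a (w i)} ∧ PumpsClass G A (w i) := by
    rintro ⟨c, ⟨_, i, rfl⟩, hc⟩
    obtain ⟨A, hA, hAi⟩ := exists_pumpsClass hne hG i
    refine ⟨⟨A, ?_⟩, i, hc, hAi⟩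
    rintro rfl
    obtain ⟨_, x, _, y, _, _, k, _, hxy, _, h₂, _⟩ := hAi
    exact hS k x y hxy h₂ hA
  choose f i hi hf using hex
  have hinj : Function.Injective f := by
    intro c c' h
    have hr := (hf c).rootConj_of_pumpsClass hne hG (h ▸ hf c')
    apply Subtype.ext
    rw [hi c, hi c']
    ext a
    exact ⟨fun ha => (rootConj T).trans' ha hr, fun ha => (rootConj T).trans' ha ((rootConj T).symm' hr)⟩
  have h1 := Nat.card_le_card_of_injective f hinj
  rw [Nat.card_coe_set_eq] at h1
  have h2 : Nat.card {A : G.NT // A ≠ G.initial} + 1 ≤ Nat.card G.NT := by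
    classical
    have := Fintype.ofFinite G.NT
    have hpos : 0 < Fintype.card G.NT := Fintype.card_pos_iff.2 ⟨G.initial⟩
    rw [Nat.card_eq_fintype_card, Nat.card_eq_fintype_card, Fintype.card_subtype_compl,
      Fintype.card_subtype_eq]
    omega
  rw [ENat.card_eq_coe_natCard]
  exact_mod_cast (Nat.succ_le_succ h1).trans h2

end LowerBound

/-! ### Upper bound: a grammar with one nonterminal per class. -/

/-- The words obtained from a sentential form by substituting members of the languages `I A` for
the nonterminals `A`. -/
def Substituted {T N : Type*} (I : N → Language T) : List (Symbol T N) → List T → Prop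
  | [], w => w = []
  | Symbol.terminal a :: s, w => ∃ w', w = a :: w' ∧ Substituted I s w'
  | Symbol.nonterminal A :: s, w => ∃ u v, w = u ++ v ∧ u ∈ I A ∧ Substituted I s v

theorem substituted_terminals_append {T N : Type*} (I : N → Language T) (u : List T)
    (s : List (Symbol T N)) (w : List T) :
    Substituted I (u.map Symbol.terminal ++ s) w ↔ ∃ w', w = u ++ w' ∧ Substituted I s w' := by
  induction u generalizing w with
  | nil => simp
  | cons a u ih => simp [Substituted, ih]

/-- The invariant principle for grammars: languages closed under the rules contain all that is
derived. It bounds the generated language from above. -/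
theorem Yields.substituted {T : Type*} {G : ContextFreeGrammar T} (I : G.NT → Language T)
    (hI : ∀ r ∈ G.rules, ∀ w, Substituted I r.output w → w ∈ I r.input) {n : ℕ}
    {s : List (Symbol T G.NT)} {w : List T} (h : Yields G n s w) : Substituted I s w := by
  induction h with
  | nil => rfl
  | terminal a _ ih => exact ⟨_, rfl, ih⟩
  | nonterminal r hr _ _ ih₁ ih₂ => exact ⟨_, _, rfl, hI r hr _ ih₁, ih₂⟩

open Classical in
/-- The rules `S → wᵢʲ` and `S → wᵢʲ vᵢ A zᵢ` (with `A` the nonterminal of the class of `wᵢ`,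
and `j < D`), and `A → P_A A` and `A → ε`. -/
noncomputable def starSumRules {T : Type*} {n m : ℕ} (w v z : Fin n → List T)
    (c : Fin n → Fin m) (P : Fin m → List T) (D : ℕ) :
    Finset (ContextFreeRule T (Option (Fin m))) :=
  (Finset.univ.image fun p : Fin n × Fin D =>
    ⟨none, (wordPow (w p.1) p.2).map Symbol.terminal⟩) ∪
  (Finset.univ.image fun p : Fin n × Fin D =>
    ⟨none, (wordPow (w p.1) p.2 ++ v p.1).map Symbol.terminal ++
      (Symbol.nonterminal (some (c p.1)) :: (z p.1).map Symbol.terminal)⟩) ∪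
  (Finset.univ.image fun a : Fin m =>
    ⟨some a, (P a).map Symbol.terminal ++ [Symbol.nonterminal (some a)]⟩) ∪
  (Finset.univ.image fun a : Fin m => ⟨some a, []⟩)

/-- The grammar with the rules `starSumRules` and the initial nonterminal `none`. -/
noncomputable def starSumGrammar {T : Type*} {n m : ℕ} (w v z : Fin n → List T)
    (c : Fin n → Fin m) (P : Fin m → List T) (D : ℕ) : ContextFreeGrammar T where
  NT := Option (Fin m)
  initial := none
  rules := starSumRules w v z c P D

section UpperBound

variable {T : Type*} {n m : ℕ} {w v z : Fin n → List T} {c : Fin n → Fin m} {P : Fin m → List T}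
  {D : ℕ}

theorem mem_starSumRules {r : ContextFreeRule T (Option (Fin m))} :
    r ∈ starSumRules w v z c P D ↔
      (∃ (i : Fin n) (j : Fin D), r = ⟨none, (wordPow (w i) j).map Symbol.terminal⟩) ∨
      (∃ (i : Fin n) (j : Fin D), r = ⟨none, (wordPow (w i) j ++ v i).map Symbol.terminal ++
        (Symbol.nonterminal (some (c i)) :: (z i).map Symbol.terminal)⟩) ∨
      (∃ a, r = ⟨some a, (P a).map Symbol.terminal ++ [Symbol.nonterminal (some a)]⟩) ∨
      ∃ a, r = ⟨some a, []⟩ := by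
  classical
  simp only [starSumRules, Finset.mem_union, Finset.mem_image, Finset.mem_univ, true_and,
    Prod.exists, or_assoc, eq_comm]

theorem none_notMem_output {r : ContextFreeRule T (Option (Fin m))}
    (hr : r ∈ starSumRules w v z c P D) : Symbol.nonterminal none ∉ r.output := by
  rcases mem_starSumRules.1 hr with
    ⟨i, j, rfl⟩ | ⟨i, j, rfl⟩ | ⟨a, rfl⟩ | ⟨a, rfl⟩ <;> simp

theorem initialAcyclic_starSumGrammar : InitialAcyclic (starSumGrammar w v z c P D) := by
  intro h
  obtain ⟨A, -, r, hr, -, α, β, h⟩ := Relation.TransGen.tail'_iff.1 h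
  refine none_notMem_output hr ?_
  rw [h]
  exact List.mem_append_left _ (List.mem_append_right _ (List.mem_singleton.2 rfl))

theorem language_starSumGrammar (d : Fin n → ℕ) (hd : ∀ i, 0 < d i) (hD : ∀ i, d i ≤ D)
    (hvz : ∀ i, wordPow (w i) (d i) = v i ++ z i) (hP : ∀ i, P (c i) = z i ++ v i) :
    (starSumGrammar w v z c P D).language = starSum w := by
  have hpow : ∀ i t, wordPow (w i) (d i * (t + 1)) = v i ++ wordPow (P (c i)) t ++ z i := by
    intro i t
    rw [wordPow_mul, hvz, hP, ← wordPow_append_swap, wordPow_add, wordPow_one, List.append_assoc]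
  ext x
  rw [Yields.mem_language, mem_starSum]
  constructor
  · rintro ⟨k, hk⟩
    -- The intended languages: the full sum for the start symbol, the powers of `P a` for the
    -- nonterminal of class `a`.
    let I : Option (Fin m) → Language T := fun A =>
      A.elim (starSum w) fun a => {x | ∃ t, x = wordPow (P a) t}
    have h := hk.substituted I ?_
    · obtain ⟨u, v, rfl, hu, rfl⟩ := h
      rw [List.append_nil]
      exact (mem_starSum w u).1 hu
    intro r hr x hx
    rcases mem_starSumRules.1 hr with
      ⟨i, j, rfl⟩ | ⟨i, j, rfl⟩ | ⟨a, rfl⟩ | ⟨a, rfl⟩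
    · have hx' := (substituted_terminals_append I (wordPow (w i) j) [] x).1
        (by rw [List.append_nil]; exact hx)
      obtain ⟨_, rfl, rfl⟩ := hx'
      exact (mem_starSum w _).2 ⟨i, j, by simp⟩
    · obtain ⟨_, rfl, _, y, rfl, ⟨t, rfl⟩, hy⟩ := (substituted_terminals_append I _ _ x).1 hx
      have hy' := (substituted_terminals_append I (z i) [] y).1
        (by rw [List.append_nil]; exact hy)
      obtain ⟨_, rfl, rfl⟩ := hy'
      refine (mem_starSum w _).2 ⟨i, j + d i * (t + 1), ?_⟩
      rw [wordPow_add, hpow]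
      simp
    · obtain ⟨_, rfl, _, y, rfl, ⟨t, rfl⟩, rfl⟩ := (substituted_terminals_append I _ _ x).1 hx
      exact ⟨t + 1, by rw [wordPow_succ]; simp⟩
    · obtain rfl : x = [] := hx
      exact ⟨0, rfl⟩
  · rintro ⟨i, q, rfl⟩
    -- Divide the exponent `q` by `d i`. A zero quotient is covered by the terminal rules; a
    -- quotient `t + 1` uses `P` exactly `t` times, the remaining period being split into `v i` and
    -- `z i`.
    rcases Nat.lt_or_ge q (d i) with hq | hq
    · exact ⟨_, Yields.rule (G := starSumGrammar w v z c P D)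
        (mem_starSumRules.2 (Or.inl ⟨i, ⟨q, hq.trans_le (hD i)⟩, rfl⟩))
        (Yields.terminals _)⟩
    · have hA : ∀ t, ∃ k, Yields (starSumGrammar w v z c P D) k
          [Symbol.nonterminal (some (c i))] (wordPow (P (c i)) t) := by
        intro t
        induction t with
        | zero =>
          exact ⟨_, Yields.rule (G := starSumGrammar w v z c P D)
            (mem_starSumRules.2 (Or.inr (Or.inr (Or.inr ⟨c i, rfl⟩)))) .nil⟩
        | succ t ih =>
          obtain ⟨k, hk⟩ := ih
          rw [wordPow_succ]
          exact ⟨_, Yields.rule (G := starSumGrammar w v z c P D)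
            (mem_starSumRules.2 (Or.inr (Or.inr (Or.inl ⟨c i, rfl⟩))))
            ((Yields.terminals _).append hk)⟩
      obtain ⟨t, ht⟩ : ∃ t, q / d i = t + 1 :=
        Nat.exists_eq_succ_of_ne_zero (Nat.div_pos hq (hd i)).ne'
      obtain ⟨k, hk⟩ := hA t
      have hj : q % d i < D := (Nat.mod_lt _ (hd i)).trans_le (hD i)
      have hqe : wordPow (w i) q =
          (wordPow (w i) (q % d i) ++ v i) ++ (wordPow (P (c i)) t ++ z i) := by
        rw [← Nat.mod_add_div q (d i), ht, wordPow_add, hpow]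
        simp
      rw [hqe]
      exact ⟨_, Yields.rule (G := starSumGrammar w v z c P D)
        (mem_starSumRules.2 (Or.inr (Or.inl ⟨i, ⟨q % d i, hj⟩, rfl⟩)))
        ((Yields.terminals _).append (hk.append (Yields.terminals _)))⟩

/-- Indices of the classes, and for each class a common power of the conjugate roots. -/
theorem exists_starSumGrammar_data (w : Fin n → List T) (hne : ∀ i, w i ≠ []) :
    ∃ (c : Fin n → Fin (rootConjClasses (Set.range w)).ncard) (P : _ → List T)
      (v z : Fin n → List T) (d : Fin n → ℕ) (D : ℕ), (∀ i, 0 < d i) ∧ (∀ i, d i ≤ D) ∧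
      (∀ i, wordPow (w i) (d i) = v i ++ z i) ∧ ∀ i, P (c i) = z i ++ v i := by
  classical
  let e : rootConjClasses (Set.range w) ≃ Fin (rootConjClasses (Set.range w)).ncard :=
    (Finite.equivFin _).trans (finCongr (Nat.card_coe_set_eq _))
  let cls : Fin n → rootConjClasses (Set.range w) := fun i =>
    ⟨{a | rootConj T a (w i)}, ⟨w i, i, rfl⟩, rfl⟩
  have hrep : ∀ a : rootConjClasses (Set.range w), ∃ s, a = cls s := by
    rintro ⟨_, ⟨_, s, rfl⟩, rfl⟩
    exact ⟨s, rfl⟩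
  choose rep hrep using hrep
  have hconj : ∀ i, rootConj T (w i) (w (rep (cls i))) := by
    intro i
    have h1 : (⟨w i, i, rfl⟩ : Set.range w) ∈ (cls i).1 := (rootConj T).refl' (w i)
    rw [hrep (cls i)] at h1
    exact h1
  choose v' z' hv' hz' using fun i => (rootConj_iff _ _).1 (hconj i)
  choose f hf using fun i => (primitiveRoot_spec (w i) (hne i)).2
  have hfpos : ∀ i, 0 < f i := by
    intro i
    rcases Nat.eq_zero_or_pos (f i) with h | h
    · exact absurd (by rw [hf i, h, wordPow_zero]) (hne i)
    · exact h
  -- The product of all root exponents is a common multiple, so powers of the `w i` in a class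
  -- become conjugate words of equal length. It is written `M + 1` to split off one copy of the
  -- root.
  obtain ⟨M, hM⟩ : ∃ M, ∏ j, f j = M + 1 :=
    Nat.exists_eq_succ_of_ne_zero (Finset.prod_pos fun j _ => hfpos j).ne'
  choose d hd using fun i => hM ▸ Finset.dvd_prod_of_mem f (Finset.mem_univ i)
  -- With root `v' z'`, the power `(v' z')^(M+1)` is cut after its first `v'`; swapping the two
  -- pieces gives `(z' v')^(M+1)`, the power of the representative's root.
  refine ⟨fun i => e (cls i), fun a => wordPow (primitiveRoot (w (rep (e.symm a)))) (M + 1), v',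
    fun i => z' i ++ wordPow (v' i ++ z' i) M, d, M + 1, ?_, ?_, ?_, ?_⟩
  · intro i
    rcases Nat.eq_zero_or_pos (d i) with h | h
    · have := hd i
      rw [h, Nat.mul_zero] at this
      omega
    · exact h
  · intro i
    rw [hd i]
    exact Nat.le_mul_of_pos_left _ (hfpos i)
  · intro i
    conv_lhs => rw [hf i]
    rw [← wordPow_mul, ← hd i, hv' i, wordPow_succ, List.append_assoc]
  · intro i
    simp only [Equiv.symm_apply_apply]
    rw [hz' i, ← wordPow_append_swap, wordPow_add, wordPow_one]
    simp

end UpperBound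

/-! ### The two complexities. -/

theorem acyclicNonterminalComplexity_le {T : Type*} {n : ℕ} (w : Fin n → List T)
    (hne : ∀ i, w i ≠ []) : acyclicNonterminalComplexity (starSum w) ≤
      (((rootConjClasses (Set.range w)).ncard + 1 : ℕ) : ℕ∞) := by
  obtain ⟨c, P, v, z, d, D, hd, hD, hvz, hP⟩ := exists_starSumGrammar_data w hne
  refine (iInf_le _ (starSumGrammar w v z c P D)).trans
    ((iInf_le _ (language_starSumGrammar d hd hD hvz hP)).trans
      ((iInf_le _ initialAcyclic_starSumGrammar).trans ?_))
  change ENat.card (Option (Fin (rootConjClasses (Set.range w)).ncard)) ≤ _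
  simp

theorem nonterminalComplexity_le_acyclic {T : Type*} (L : Language T) :
    nonterminalComplexity L ≤ acyclicNonterminalComplexity L :=
  le_iInf fun G => le_iInf fun hG => le_iInf fun _ => iInf₂_le G hG

theorem acyclicNonterminalComplexity_starSum {T : Type*} {n : ℕ} (w : Fin n → List T)
    (hne : ∀ i, w i ≠ []) : acyclicNonterminalComplexity (starSum w) =
      (((rootConjClasses (Set.range w)).ncard + 1 : ℕ) : ℕ∞) :=
  le_antisymm (acyclicNonterminalComplexity_le w hne) <|
    le_iInf fun _ => le_iInf fun hG => le_iInf fun hac =>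
      ncard_rootConjClasses_add_one_le hne hG fun _ _ _ _ _ => hac

theorem nonterminalComplexity_starSum {T : Type*} {n : ℕ} (w : Fin n → List T)
    (hne : ∀ i, w i ≠ []) (hw : ∃ i j, w i ++ w j ≠ w j ++ w i) :
    nonterminalComplexity (starSum w) =
      (((rootConjClasses (Set.range w)).ncard + 1 : ℕ) : ℕ∞) := by
  obtain ⟨i, j, hij⟩ := hw
  exact le_antisymm
    ((nonterminalComplexity_le_acyclic _).trans (acyclicNonterminalComplexity_le w hne)) <|
    le_iInf fun _ => le_iInf fun hG => ncard_rootConjClasses_add_one_le hne hG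
      fun _ _ _ hxy h => absurd (commute_of_initial_pump hne hG hxy h i j) hij

theorem mainTheorem1 {T : Type*} (n : ℕ) (w : Fin n → List T)
    (hinj : Function.Injective w) (hne : ∀ i, w i ≠ []) (k : ℕ) (hk : 1 < k) :
    (acyclicNonterminalComplexity (starSum w) = k ↔
      (rootConjClasses (Set.range w)).ncard = k - 1) ∧
    ((∃ i j, w i ++ w j ≠ w j ++ w i) →
      (nonterminalComplexity (starSum w) = k ↔
        (rootConjClasses (Set.range w)).ncard = k - 1)) := by
  -- The truncated subtraction `k - 1` is harmless because `k > 1`.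
  have key : (((rootConjClasses (Set.range w)).ncard + 1 : ℕ) : ℕ∞) = k ↔
      (rootConjClasses (Set.range w)).ncard = k - 1 := by
    rw [Nat.cast_inj]
    omega
  refine ⟨?_, fun hw => ?_⟩
  · rw [acyclicNonterminalComplexity_starSum w hne]
    exact key
  · rw [nonterminalComplexity_starSum w hne hw]
    exact key
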